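/- Let $\Bbbk$ be a field of characteristic zero, and let $W_+$ be the positive Witt algebra over $\Bbbk$: the Lie algebra with $\Bbbk$-basis $\{e_n : n\in\mathbb{Z}_{\ge 1}\}$ and Lie bracket $[e_i,e_j]=(j-i)e_{i+j}$. Let $W_+$ act on its symmetric algebra $\mathrm{S}(W_+)$ by the derivations that extend the adjoint action, and let $\mathrm{S}^2(W_+)$ be the submodule of quadratic elements, that is, the span of the products $xy$ with $x,y\in W_+$. Then $\mathrm{S}^2(W_+)$ is a noetherian $W_+$-module: its $W_+$-submodules satisfy the ascending chain condition. -/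

import Mathlib

noncomputable section

/-- The positive Witt algebra `W₊` over `k`: the vector space with basis `e n`, `n ≥ 1`. -/
def PositiveWitt (k : Type*) [Field k] : Type _ := ℕ+ →₀ k

namespace PositiveWitt

variable {k : Type*} [Field k]

instance : AddCommGroup (PositiveWitt k) := inferInstanceAs (AddCommGroup (ℕ+ →₀ k))

instance : Module k (PositiveWitt k) := inferInstanceAs (Module k (ℕ+ →₀ k))

/-- The standard basis `e n`, `n ≥ 1`, of `W₊`. -/
def e : Module.Basis ℕ+ k (PositiveWitt k) := ⟨LinearEquiv.refl k (ℕ+ →₀ k)⟩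

/-- The bilinear map with `(e i, e j) ↦ (j - i) e (i + j)`. -/
def bracketMap : PositiveWitt k →ₗ[k] PositiveWitt k →ₗ[k] PositiveWitt k :=
  e.constr k fun i => e.constr k fun j => (((j : ℕ) : k) - ((i : ℕ) : k)) • e (i + j)

theorem bracketMap_e_e (i j : ℕ+) :
    bracketMap (e i : PositiveWitt k) (e j) = (((j : ℕ) : k) - ((i : ℕ) : k)) • e (i + j) := by
  simp [bracketMap, Module.Basis.constr_basis]

theorem bracketMap_skew (x y : PositiveWitt k) : bracketMap x y = -bracketMap y x := by
  have h : (bracketMap (k := k)) = -(bracketMap (k := k)).flip := by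
    refine e.ext fun i => e.ext fun j => ?_
    simp only [LinearMap.neg_apply, LinearMap.flip_apply, bracketMap_e_e, add_comm j i,
      ← neg_smul, neg_sub]
  exact congrArg (fun B => B x y) h

theorem induction_e {p : PositiveWitt k → Prop} (basis : ∀ i, p (e i)) (zero : p 0)
    (add : ∀ x y, p x → p y → p (x + y)) (smul : ∀ (t : k) x, p x → p (t • x))
    (x : PositiveWitt k) : p x := by
  have hx : x ∈ Submodule.span k (Set.range (e : ℕ+ → PositiveWitt k)) := by
    rw [e.span_eq]; trivial
  induction hx using Submodule.span_induction with
  | mem y hy => obtain ⟨i, rfl⟩ := hy; exact basis i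
  | zero => exact zero
  | add y z _ _ hy hz => exact add y z hy hz
  | smul t y _ hy => exact smul t y hy

theorem bracketMap_self (x : PositiveWitt k) : bracketMap x x = 0 := by
  induction x using induction_e with
  | basis i => simp [bracketMap_e_e]
  | zero => simp
  | add x y hx hy => simp [hx, hy, bracketMap_skew x y]
  | smul t x hx => simp [hx]

theorem bracketMap_leibniz (x y z : PositiveWitt k) :
    bracketMap x (bracketMap y z) =
      bracketMap (bracketMap x y) z + bracketMap y (bracketMap x z) := by
  induction x using induction_e with
  | zero => simp
  | add x x' hx hx' => simp only [map_add, LinearMap.add_apply, hx, hx']; abel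
  | smul t x hx => simp only [map_smul, LinearMap.smul_apply, hx, smul_add]
  | basis i =>
    induction y using induction_e with
    | zero => simp
    | add y y' hy hy' => simp only [map_add, LinearMap.add_apply, hy, hy']; abel
    | smul t y hy => simp only [map_smul, LinearMap.smul_apply, hy, smul_add]
    | basis j =>
      induction z using induction_e with
      | zero => simp
      | add z z' hz hz' => simp only [map_add, hz, hz']; abel
      | smul t z hz => simp only [map_smul, hz, smul_add]
      | basis l =>
        simp only [bracketMap_e_e, map_smul, LinearMap.smul_apply, smul_smul,
          add_left_comm j i l, ← add_assoc, ← add_smul, PNat.add_coe, Nat.cast_add]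
        congr 1
        ring

instance : LieRing (PositiveWitt k) where
  bracket x y := bracketMap x y
  add_lie x y z := by simp
  lie_add x y z := by simp
  lie_self x := bracketMap_self x
  leibniz_lie x y z := bracketMap_leibniz x y z

instance : LieAlgebra k (PositiveWitt k) where
  lie_smul t x y := (bracketMap x).map_smul t y

theorem lie_e_e (i j : ℕ+) :
    ⁅(e i : PositiveWitt k), (e j : PositiveWitt k)⁆ =
      (((j : ℕ) : k) - ((i : ℕ) : k)) • e (i + j) :=
  bracketMap_e_e i j

end PositiveWitt

namespace SymmetricAlgebra

section Derivation

variable {R M : Type*} [CommRing R] [AddCommGroup M] [Module R M]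

/-- The algebra map `a ↦ (a, D a)` into the square-zero extension which encodes the derivation
`D` of the symmetric algebra that extends a linear map `f` given on generators. -/
def derivHom (f : M →ₗ[R] SymmetricAlgebra R M) :
    SymmetricAlgebra R M →ₐ[R]
      TrivSqZeroExt (SymmetricAlgebra R M) (SymmetricAlgebra R M) :=
  lift ((TrivSqZeroExt.inlAlgHom R (SymmetricAlgebra R M)
      (SymmetricAlgebra R M)).toLinearMap ∘ₗ ι R M +
    (TrivSqZeroExt.inrHom (SymmetricAlgebra R M)
      (SymmetricAlgebra R M)).restrictScalars R ∘ₗ f)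

theorem fst_derivHom (f : M →ₗ[R] SymmetricAlgebra R M) (a : SymmetricAlgebra R M) :
    (derivHom f a).fst = a := by
  have h : (TrivSqZeroExt.fstHom R (SymmetricAlgebra R M) (SymmetricAlgebra R M)).comp
      (derivHom f) = AlgHom.id R (SymmetricAlgebra R M) := by
    apply algHom_ext
    ext x
    simp [derivHom]
  exact congrArg (fun F => F a) h

/-- The unique derivation of the symmetric algebra extending a linear map on generators. -/
def deriv (f : M →ₗ[R] SymmetricAlgebra R M) :
    Derivation R (SymmetricAlgebra R M) (SymmetricAlgebra R M) :=
  Derivation.mk' ((TrivSqZeroExt.sndHom (SymmetricAlgebra R M)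
      (SymmetricAlgebra R M)).restrictScalars R ∘ₗ (derivHom f).toLinearMap) (by
    intro a b
    simp [fst_derivHom, mul_comm])

theorem deriv_ι (f : M →ₗ[R] SymmetricAlgebra R M) (x : M) : deriv f (ι R M x) = f x := by
  simp [deriv, derivHom]

theorem derivation_ext {D E : Derivation R (SymmetricAlgebra R M) (SymmetricAlgebra R M)}
    (h : ∀ x, D (ι R M x) = E (ι R M x)) : D = E := by
  ext a
  induction a using SymmetricAlgebra.induction with
  | algebraMap r => simp
  | ι x => exact h x
  | mul a b ha hb => simp [ha, hb]
  | add a b ha hb => simp [ha, hb]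

end Derivation

section Lie

variable (R L : Type*) [CommRing R] [LieRing L] [LieAlgebra R L]

/-- The action of a Lie algebra `L` on its symmetric algebra: `x : L` acts as the derivation
`{x, -}` that extends `ad x`. -/
def lieAction : L →ₗ⁅R⁆ Derivation R (SymmetricAlgebra R L) (SymmetricAlgebra R L) where
  toFun x := deriv (ι R L ∘ₗ (LieAlgebra.ad R L x : L →ₗ[R] L))
  map_add' x y := derivation_ext fun z => by simp [deriv_ι]
  map_smul' t x := derivation_ext fun z => by simp [deriv_ι]
  map_lie' {x y} := derivation_ext fun z => by
    simp [deriv_ι, Derivation.commutator_apply]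

instance instLieRingModule : LieRingModule L (SymmetricAlgebra R L) where
  bracket x a := lieAction R L x a
  add_lie x y a := by simp
  lie_add x a b := by simp
  leibniz_lie x y a := by
    rw [LieHom.map_lie, Derivation.commutator_apply, sub_add_cancel]

instance instLieModule : LieModule R L (SymmetricAlgebra R L) where
  smul_lie t x a :=
    congrArg (fun D : Derivation R _ _ => D a) ((lieAction R L).map_smul t x)
  lie_smul t x a := (lieAction R L x).map_smul t a

theorem lie_ι (x y : L) : ⁅x, ι R L y⁆ = ι R L ⁅x, y⁆ := deriv_ι _ _

theorem lie_mul (x : L) (a b : SymmetricAlgebra R L) : ⁅x, a * b⁆ = a * ⁅x, b⁆ + b * ⁅x, a⁆ :=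
  (lieAction R L x).leibniz a b

/-- The `n`-th symmetric power `Sⁿ(L)`, spanned by the products of `n` elements of `L`
in the symmetric algebra, as an `L`-submodule. -/
def symPow (n : ℕ) : LieSubmodule R L (SymmetricAlgebra R L) where
  __ := (LinearMap.range (ι R L)) ^ n
  lie_mem {x a} ha := by
    change ⁅x, a⁆ ∈ (LinearMap.range (ι R L)) ^ n
    change a ∈ (LinearMap.range (ι R L)) ^ n at ha
    induction ha using Submodule.pow_induction_on_left' with
    | algebraMap r =>
      have h : ⁅x, algebraMap R (SymmetricAlgebra R L) r⁆ = 0 :=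
        (lieAction R L x).map_algebraMap r
      rw [h]
      exact Submodule.zero_mem _
    | add a b i _ _ ha hb => rw [lie_add]; exact Submodule.add_mem _ ha hb
    | mem_mul m hm i a hmem ha =>
      obtain ⟨y, rfl⟩ := hm
      rw [lie_mul, lie_ι, pow_succ', mul_comm a]
      exact Submodule.add_mem _ (Submodule.mul_mem_mul ⟨y, rfl⟩ ha)
        (Submodule.mul_mem_mul ⟨⁅x, y⁆, rfl⟩ hmem)

end Lie

end SymmetricAlgebra

end

/-!
Identify `S²(W₊)` with the quotient of `k[x, y]` by the exchange of `x` and `y`, where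
`e (a + 1) * e (b + 1)` is the class of `x ^ a * y ^ b`. Then `e (n + 1)` acts as the operator
`x ^ n ∂ - ∂(x ^ n)` with `∂ = x² d/dx`, plus the same operator in `y`. In a third difference of
products of two such operators the terms in a single variable cancel, and there remains a cross
operator, linear in its symbol, which can be any multiple of `(x - y) ^ 4` by a symmetric
polynomial. A fourth difference of products of two cross operators is a multiplication operator.
So the preimage in `k[x, y]` of a nonzero submodule contains an ideal `(p)` with `p ≠ 0`. The
largest ideal in it is stable under `δ ∂/∂x` and `δ ∂/∂y` with `δ = x² y² (x - y)`, hence contains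
a power of `δ`, by differentiating `p` down to a constant. The quotient of `k[x, y]` by `δ ^ m` has
a finite filtration whose factors are density modules `k[t]` in one variable. A nonzero submodule of
a density module contains polynomials of all large degrees, so it has finite codimension, and
density modules are noetherian.
-/

noncomputable section

section Noetherian

theorem wellFoundedGT_of_forall_Ici {α : Type*} [PartialOrder α] [OrderBot α]
    (h : ∀ a : α, a ≠ ⊥ → WellFoundedGT (Set.Ici a)) : WellFoundedGT α := by
  have acc_of_ne_bot (a : α) (ha : a ≠ ⊥) : Acc (· > ·) a :=
    (h a ha).wf.induction (C := fun b => Acc (· > ·) b.1) ⟨a, le_rfl⟩ fun b ih =>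
      .intro _ fun c hc => ih ⟨c, b.2.trans hc.le⟩ hc
  exact ⟨⟨fun a => .intro a fun b hab => acc_of_ne_bot b (bot_le.trans_lt hab).ne'⟩⟩

variable {R P : Type*} [Ring R] [AddCommGroup P] [Module R P]

theorem wellFoundedGT_Ici_iff_isNoetherian_quotient (N : Submodule R P) :
    WellFoundedGT (Set.Ici N) ↔ IsNoetherian R (P ⧸ N) := by
  rw [isNoetherian_iff']
  exact ⟨fun _ => N.comapMkQRelIso.strictMono.wellFoundedGT,
    fun _ => N.comapMkQRelIso.symm.strictMono.wellFoundedGT⟩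

theorem isNoetherian_of_forall_quotient
    (h : ∀ N : Submodule R P, N ≠ ⊥ → IsNoetherian R (P ⧸ N)) : IsNoetherian R P :=
  isNoetherian_iff'.2 <| wellFoundedGT_of_forall_Ici fun N hN =>
    (wellFoundedGT_Ici_iff_isNoetherian_quotient N).2 (h N hN)

theorem isNoetherian_quotient_of_le {I J : Submodule R P} (hIJ : I ≤ J)
    [IsNoetherian R (P ⧸ J)]
    (hJI : IsNoetherian R (J.map I.mkQ)) : IsNoetherian R (P ⧸ I) :=
  (isNoetherian_iff_submodule_quotient (J.map I.mkQ)).2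
    ⟨hJI, isNoetherian_of_linearEquiv (Submodule.quotientQuotientEquivQuotient I J hIJ).symm⟩

end Noetherian

section InvariantSubspace

variable {k E : Type*} [CommRing k] [AddCommGroup E] [Module k E]

/-- A subspace preserved by every operator of `S`, as a submodule over the algebra generated
by `S`. -/
def invariantSubmodule (S : Set (Module.End k E)) (V : Submodule k E)
    (hV : ∀ T ∈ S, ∀ v ∈ V, T v ∈ V) : Submodule (Algebra.adjoin k S) E where
  __ := V
  smul_mem' T := Algebra.adjoin_induction (p := fun T _ => ∀ v ∈ V, T v ∈ V) hV
    (fun r _ => V.smul_mem r)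
    (fun _ _ _ _ hT hT' v hv => V.add_mem (hT v hv) (hT' v hv))
    (fun _ _ _ _ hT hT' v hv => hT _ (hT' v hv)) T.2 _

theorem mem_invariantSubmodule {S : Set (Module.End k E)} {V : Submodule k E}
    (hV : ∀ T ∈ S, ∀ v ∈ V, T v ∈ V) {v : E} : v ∈ invariantSubmodule S V hV ↔ v ∈ V := Iff.rfl

theorem apply_mem_of_mem_adjoin {S : Set (Module.End k E)} (N : Submodule (Algebra.adjoin k S) E)
    {T : Module.End k E} (hT : T ∈ S) {v : E} (hv : v ∈ N) : T v ∈ N :=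
  N.smul_mem ⟨T, Algebra.subset_adjoin hT⟩ hv

end InvariantSubspace

section DerivationOperators

variable {k R : Type*} [CommRing k] [CommRing R] [Algebra k R]

/-- The operator `q ↦ u * d q - d u * q`. The vector fields `u d` and `q d` have the bracket
`(u * d q - d u * q) d`, so this is the adjoint action of `u d` in coordinates. -/
def wronskianOp (d : Derivation k R R) (u : R) : Module.End k R :=
  u • (d : R →ₗ[k] R) - d u • LinearMap.id

theorem wronskianOp_apply (d : Derivation k R R) (u q : R) :
    wronskianOp d u q = u * d q - d u * q := rfl

theorem third_difference_wronskianOp (d : Derivation k R R) (x u v q : R) :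
    wronskianOp d (x ^ 3 * u) (wronskianOp d v q)
      - 3 • wronskianOp d (x ^ 2 * u) (wronskianOp d (x * v) q)
      + 3 • wronskianOp d (x * u) (wronskianOp d (x ^ 2 * v) q)
      - wronskianOp d u (wronskianOp d (x ^ 3 * v) q) = 0 := by
  simp only [wronskianOp_apply, pow_succ', pow_zero, mul_one, map_sub, map_add,
    Derivation.leibniz, smul_eq_mul]
  ring

/-- The operator `q ↦ Φ * d₀ (d₁ q) - d₀ Φ * d₁ q - d₁ Φ * d₀ q + d₀ (d₁ Φ) * q`: for `Φ = u * v`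
with `d₁ u = d₀ v = 0` it is the composition of `wronskianOp d₀ u` and `wronskianOp d₁ v`, and it
is linear in the symbol `Φ`. -/
def crossOp (d₀ d₁ : Derivation k R R) : R →ₗ[k] Module.End k R :=
  LinearMap.mk₂ k (fun Φ q => Φ * d₀ (d₁ q) - d₀ Φ * d₁ q - d₁ Φ * d₀ q + d₀ (d₁ Φ) * q)
    (fun _ _ _ => by simp only [map_add]; ring)
    (fun _ _ _ => by simp only [Derivation.map_smul, smul_sub, smul_add, smul_mul_assoc])
    (fun _ _ _ => by simp only [map_add]; ring)
    (fun _ _ _ => by simp only [Derivation.map_smul, smul_sub, smul_add, mul_smul_comm])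

variable {d₀ d₁ : Derivation k R R}

theorem crossOp_apply (Φ q : R) : crossOp d₀ d₁ Φ q =
    Φ * d₀ (d₁ q) - d₀ Φ * d₁ q - d₁ Φ * d₀ q + d₀ (d₁ Φ) * q := rfl

theorem crossOp_comm (h : ∀ q, d₀ (d₁ q) = d₁ (d₀ q)) : crossOp d₀ d₁ = crossOp d₁ d₀ := by
  ext Φ q
  simp only [crossOp_apply, h]
  ring

theorem wronskianOp_wronskianOp (h : ∀ q, d₀ (d₁ q) = d₁ (d₀ q)) {u v : R} (hu : d₁ u = 0)
    (hv : d₀ v = 0) (q : R) :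
    wronskianOp d₀ u (wronskianOp d₁ v q) = crossOp d₀ d₁ (u * v) q := by
  simp only [wronskianOp_apply, crossOp_apply, map_sub, map_add, Derivation.leibniz, smul_eq_mul,
    hu, hv, h v, map_zero]
  ring

section

variable {s : R} (hs : d₀ (d₁ s) = 0)
include hs

theorem crossOp_mul_left (Φ q : R) :
    crossOp d₀ d₁ (s * Φ) q = 2 • (s * crossOp d₀ d₁ Φ q) - crossOp d₀ d₁ Φ (s * q) := by
  simp only [crossOp_apply, Derivation.leibniz, map_add, smul_eq_mul, hs]
  ring

theorem crossOp_mul_mul (Φ q : R) :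
    crossOp d₀ d₁ Φ (s * (s * q)) = 2 • (s * crossOp d₀ d₁ Φ (s * q))
      - s * (s * crossOp d₀ d₁ Φ q) + 2 • (d₀ s * d₁ s * Φ * q) := by
  simp only [crossOp_apply, Derivation.leibniz, map_add, smul_eq_mul, hs]
  ring

end

theorem fourth_difference_crossOp {s : R} (hs : d₀ (d₁ s) = 0) (Φ Ψ q : R) :
    crossOp d₀ d₁ (s ^ 4 * Φ) (crossOp d₀ d₁ Ψ q)
      - 4 • crossOp d₀ d₁ (s ^ 3 * Φ) (crossOp d₀ d₁ (s * Ψ) q)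
      + 6 • crossOp d₀ d₁ (s ^ 2 * Φ) (crossOp d₀ d₁ (s ^ 2 * Ψ) q)
      - 4 • crossOp d₀ d₁ (s * Φ) (crossOp d₀ d₁ (s ^ 3 * Ψ) q)
      + crossOp d₀ d₁ Φ (crossOp d₀ d₁ (s ^ 4 * Ψ) q) =
    96 • ((d₀ s * d₁ s) ^ 2 * Φ * Ψ * q) := by
  have hΨ (p : R) : d₀ s * d₁ s * Ψ * (s * p) = s * (d₀ s * d₁ s * Ψ * p) := by ring
  have hΦ : d₀ s * d₁ s * Φ * (d₀ s * d₁ s * Ψ * q) = (d₀ s * d₁ s) ^ 2 * Φ * Ψ * q := by ring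
  simp only [pow_succ', pow_zero, mul_one, mul_assoc s, crossOp_mul_left hs, crossOp_mul_mul hs,
    mul_sub, mul_add, mul_smul_comm, map_sub, map_add, map_nsmul, hΨ, hΦ]
  ring

end DerivationOperators

section DensityOperators

open Polynomial

section CommRing

variable {k : Type*} [CommRing k]

/-- The action of the vector field `t ^ (n + 2) d/dt` on densities over the line: the operator
`v ↦ t ^ (n + 2) * v' + c * t ^ (n + 1) * v` on `k[t]`. -/
def densityOp (n : ℕ) (c : k) : Module.End k k[X] :=
  LinearMap.mulLeft k (X ^ (n + 2)) ∘ₗ derivative + LinearMap.mulLeft k (C c * X ^ (n + 1))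

theorem densityOp_apply (n : ℕ) (c : k) (v : k[X]) :
    densityOp n c v = X ^ (n + 2) * derivative v + C c * X ^ (n + 1) * v := rfl

theorem coeff_densityOp (n i : ℕ) (c : k) (v : k[X]) :
    (densityOp n c v).coeff (i + (n + 1)) = (i + c) * v.coeff i := by
  have h : densityOp n c v = X ^ (n + 1) * (X * derivative v + C c * v) := by
    rw [densityOp_apply]; ring
  rw [h, coeff_X_pow_mul, coeff_add, coeff_C_mul, add_mul]
  congr 1
  cases i with
  | zero => simp
  | succ i => rw [coeff_X_mul, coeff_derivative]; push_cast; ring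

theorem natDegree_densityOp [NoZeroDivisors k] {n : ℕ} {c : k} {v : k[X]} (hv : v ≠ 0)
    (hc : (v.natDegree : k) + c ≠ 0) :
    (densityOp n c v).natDegree = v.natDegree + (n + 1) := by
  refine natDegree_eq_of_le_of_coeff_ne_zero (natDegree_le_iff_coeff_eq_zero.2 fun i hi => ?_) ?_
  · obtain ⟨j, rfl⟩ : ∃ j, i = j + (n + 1) := ⟨i - (n + 1), by omega⟩
    rw [coeff_densityOp, coeff_eq_zero_of_natDegree_lt (by omega), mul_zero]
  · rw [coeff_densityOp]
    exact mul_ne_zero hc (leadingCoeff_ne_zero.2 hv)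

end CommRing

variable {k : Type*} [Field k]

theorem sup_degreeLT_eq_top {V : Submodule k k[X]} {D : ℕ}
    (hV : ∀ j ≥ D, ∃ w ∈ V, w.degree = j) : V ⊔ degreeLT k D = ⊤ := by
  refine eq_top_iff.2 fun q _ => ?_
  induction hq : q.degree using WellFoundedLT.induction generalizing q with
  | _ d ih =>
    by_cases hD : q ∈ degreeLT k D
    · exact Submodule.mem_sup_right hD
    have hq0 : q ≠ 0 := fun h => hD (h ▸ Submodule.zero_mem _)
    rw [mem_degreeLT, degree_eq_natDegree hq0, Nat.cast_lt, not_lt] at hD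
    obtain ⟨w, hw, hdeg⟩ := hV _ hD
    have hw0 : w ≠ 0 := fun h => by simp [h] at hdeg
    set c := q.leadingCoeff / w.leadingCoeff
    have hc : c ≠ 0 := div_ne_zero (leadingCoeff_ne_zero.2 hq0) (leadingCoeff_ne_zero.2 hw0)
    have hlt : (q - C c * w).degree < d := hq ▸ degree_sub_lt_left
      (by rw [degree_C_mul hc, hdeg, degree_eq_natDegree hq0]) hq0
      (by rw [leadingCoeff_mul, leadingCoeff_C, div_mul_cancel₀ _ (leadingCoeff_ne_zero.2 hw0)])
    rw [← sub_add_cancel q (C c * w)]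
    refine Submodule.add_mem _ (ih _ hlt _ trivial rfl) (Submodule.mem_sup_left ?_)
    exact smul_eq_C_mul (p := w) c ▸ V.smul_mem c hw

theorem finite_quotient_of_densityOp_mem {κ : ℕ → k}
    (hκ : ∀ d : ℕ, ∃ m, ∀ n ≥ m, (d : k) + κ n ≠ 0) {V : Submodule k k[X]} (hV0 : V ≠ ⊥)
    (hV : ∀ n, ∀ v ∈ V, densityOp n (κ n) v ∈ V) : Module.Finite k (k[X] ⧸ V) := by
  obtain ⟨v, hv, hv0⟩ := V.ne_bot_iff.1 hV0
  obtain ⟨m, hm⟩ := hκ v.natDegree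
  have hsup : V ⊔ degreeLT k (v.natDegree + (m + 1)) = ⊤ := sup_degreeLT_eq_top fun j hj => by
    obtain ⟨i, rfl⟩ := Nat.exists_eq_add_of_le hj
    have hdeg := natDegree_densityOp (n := m + i) hv0 (hm (m + i) (Nat.le_add_right m i))
    refine ⟨_, hV (m + i) v hv, ?_⟩
    rw [degree_eq_iff_natDegree_eq_of_pos (by omega), hdeg]
    omega
  have : Module.Finite k (degreeLT k (v.natDegree + (m + 1))) :=
    Module.Finite.equiv (degreeLTEquiv k _).symm
  refine Module.Finite.of_surjective (V.mkQ ∘ₗ (degreeLT k (v.natDegree + (m + 1))).subtype) ?_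
  rw [← LinearMap.range_eq_top, LinearMap.range_comp, Submodule.range_subtype,
    Submodule.map_mkQ_eq_top, hsup]

theorem isNoetherian_of_densityOp {A P : Type*} [Ring A] [Algebra k A] [AddCommGroup P]
    [Module k P] [Module A P] [IsScalarTower k A P] {κ : ℕ → k}
    (hκ : ∀ d : ℕ, ∃ m, ∀ n ≥ m, (d : k) + κ n ≠ 0) {f : k[X] →ₗ[k] P}
    (hf : Function.Surjective f)
    (hop : ∀ n, ∃ a : A, ∀ v, a • f v = f (densityOp n (κ n) v)) : IsNoetherian A P := by
  refine isNoetherian_of_forall_quotient fun N hN => ?_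
  let V := (N.restrictScalars k).comap f
  have hV0 : V ≠ ⊥ := by
    obtain ⟨x, hx, hx0⟩ := N.ne_bot_iff.1 hN
    obtain ⟨v, rfl⟩ := hf x
    exact V.ne_bot_iff.2 ⟨v, hx, fun h => hx0 (by rw [h, map_zero])⟩
  have hV : ∀ n, ∀ v ∈ V, densityOp n (κ n) v ∈ V := fun n v hv => by
    obtain ⟨a, ha⟩ := hop n
    exact (ha v ▸ N.smul_mem a hv : f (densityOp n (κ n) v) ∈ N)
  have := finite_quotient_of_densityOp_mem hκ hV0 hV
  have hker : V ≤ LinearMap.ker (N.mkQ.restrictScalars k ∘ₗ f) := fun v hv =>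
    (Submodule.Quotient.mk_eq_zero N).2 (show f v ∈ N from hv)
  have : Module.Finite k (P ⧸ N) := Module.Finite.of_surjective (V.liftQ _ hker) fun y => by
    obtain ⟨x, rfl⟩ := N.mkQ_surjective y
    obtain ⟨v, rfl⟩ := hf x
    exact ⟨V.mkQ v, rfl⟩
  exact isNoetherian_of_tower k inferInstance

theorem wellFoundedGT_Ici_of_densityOp {A P : Type*} [Ring A] [Algebra k A] [AddCommGroup P]
    [Module k P] [Module A P] [IsScalarTower k A P] {I J : Submodule A P} (hIJ : I ≤ J)
    (hJ : WellFoundedGT (Set.Ici J)) {κ : ℕ → k}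
    (hκ : ∀ d : ℕ, ∃ m, ∀ n ≥ m, (d : k) + κ n ≠ 0) {f : k[X] →ₗ[k] P} (hfJ : ∀ v, f v ∈ J)
    (hf : ∀ x ∈ J, ∃ v, x - f v ∈ I)
    (hop : ∀ n, ∃ a : A, ∀ v, a • f v - f (densityOp n (κ n) v) ∈ I) :
    WellFoundedGT (Set.Ici I) := by
  rw [wellFoundedGT_Ici_iff_isNoetherian_quotient] at hJ ⊢
  let g : k[X] →ₗ[k] J.map I.mkQ := (I.mkQ.restrictScalars k ∘ₗ f).codRestrict
    ((J.map I.mkQ).restrictScalars k) fun v => Submodule.mem_map_of_mem (hfJ v)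
  refine isNoetherian_quotient_of_le hIJ (isNoetherian_of_densityOp hκ (f := g) ?_ fun n => ?_)
  · rintro ⟨_, x, hx, rfl⟩
    obtain ⟨v, hv⟩ := hf x hx
    exact ⟨v, Subtype.ext ((Submodule.Quotient.eq I).2 hv).symm⟩
  · obtain ⟨a, ha⟩ := hop n
    exact ⟨a, fun v => Subtype.ext ((Submodule.Quotient.eq I).2 (ha v))⟩

end DensityOperators

section PolynomialIdeals

open MvPolynomial

theorem pderiv_pderiv_comm {R σ : Type*} [CommRing R] (i j : σ) (q : MvPolynomial σ R) :
    pderiv i (pderiv j q) = pderiv j (pderiv i q) := by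
  classical
  have h : ⁅pderiv (R := R) i, pderiv (R := R) j⁆ = 0 := derivation_ext fun l => by
    simp [Derivation.commutator_apply, pderiv_X, Pi.single_apply, apply_ite]
  simpa [Derivation.commutator_apply, sub_eq_zero] using DFunLike.congr_fun h q

theorem totalDegree_pderiv_lt {R σ : Type*} [CommSemiring R] {i : σ} {q : MvPolynomial σ R}
    (hq : pderiv i q ≠ 0) : (pderiv i q).totalDegree < q.totalDegree := by
  classical
  obtain ⟨v, hv, hdeg⟩ := Finset.exists_mem_eq_sup _ (support_nonempty.2 hq) Finsupp.degree
  have hv' : v + Finsupp.single i 1 ∈ q.support := by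
    rw [mem_support_iff, coeff_pderiv] at hv
    exact mem_support_iff.2 (left_ne_zero_of_mul hv)
  have h : (v + Finsupp.single i 1).degree ≤ q.totalDegree := le_totalDegree hv'
  rw [map_add, Finsupp.degree_single] at h
  exact hdeg.trans_lt h

theorem exists_pderiv_ne_zero {R σ : Type*} [CommRing R] [IsDomain R] [CharZero R]
    {q : MvPolynomial σ R} (hq : q.totalDegree ≠ 0) : ∃ i, pderiv i q ≠ 0 := by
  simp only [ne_eq, totalDegree_eq_zero_iff, not_forall] at hq
  obtain ⟨u, hu, i, hi⟩ := hq
  refine ⟨i, fun h => ?_⟩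
  have hcoeff := congrArg (coeff (u - Finsupp.single i 1)) h
  rw [coeff_pderiv, Finsupp.sub_add_single_one_cancel hi, coeff_zero] at hcoeff
  exact (mul_ne_zero (mem_support_iff.1 hu) (Nat.cast_add_one_ne_zero _)) hcoeff

theorem dvd_sub_aeval {R σ : Type*} [CommRing R] {l : MvPolynomial σ R} {i : σ}
    {φ : MvPolynomial σ R →ₐ[R] Polynomial R}
    (hφ : ∀ j, l ∣ X j - Polynomial.aeval (X i) (φ (X j))) (h : MvPolynomial σ R) :
    l ∣ h - Polynomial.aeval (X i) (φ h) := by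
  have hquot : Ideal.Quotient.mkₐ R (Ideal.span {l}) =
      ((Ideal.Quotient.mkₐ R (Ideal.span {l})).comp (Polynomial.aeval (X i))).comp φ :=
    MvPolynomial.algHom_ext fun j => Ideal.Quotient.eq.2 (Ideal.mem_span_singleton.2 (hφ j))
  exact Ideal.mem_span_singleton.1 (Ideal.Quotient.eq.1 (DFunLike.congr_fun hquot h))

variable {k σ : Type*} [Field k] [CharZero k]

theorem exists_pow_mem_of_mul_pderiv_mem {J : Ideal (MvPolynomial σ k)} {δ : MvPolynomial σ k}
    (hJ : ∀ i, ∀ p ∈ J, δ * pderiv i p ∈ J) {q : MvPolynomial σ k} (hq0 : q ≠ 0) (hq : q ∈ J) :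
    ∃ m, δ ^ m ∈ J := by
  suffices ∀ m, δ ^ m * q ∈ J → ∃ m, δ ^ m ∈ J from this 0 (by rwa [pow_zero, one_mul])
  clear hq
  induction hd : q.totalDegree using Nat.strong_induction_on generalizing q with
  | _ d ih =>
    intro m hm
    by_cases hdeg : q.totalDegree = 0
    · obtain ⟨c, rfl⟩ : ∃ c, q = C c := ⟨_, totalDegree_eq_zero_iff_eq_C.1 hdeg⟩
      have hc : IsUnit (C c : MvPolynomial σ k) :=
        (isUnit_iff_ne_zero.2 fun h => hq0 (by rw [h, C_0])).map C
      exact ⟨m, (Ideal.mul_unit_mem_iff_mem J hc).1 hm⟩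
    obtain ⟨i, hi⟩ := exists_pderiv_ne_zero hdeg
    refine ih _ (hd ▸ totalDegree_pderiv_lt hi) hi rfl (m + 1) ?_
    have hleibniz : δ ^ (m + 1) * pderiv i q =
        δ * pderiv i (δ ^ m * q) - m * pderiv i δ * (δ ^ m * q) := by
      cases m with
      | zero => simp
      | succ m =>
        simp only [Derivation.leibniz, pderiv_pow, smul_eq_mul, Nat.add_sub_cancel]
        ring
    rw [hleibniz]
    exact J.sub_mem (hJ i _ hm) (J.mul_mem_left _ hm)

end PolynomialIdeals

section IdealCore

variable {k R : Type*} [CommRing k] [CommRing R] [Algebra k R]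

/-- The largest ideal contained in a subspace of a commutative algebra. -/
def idealCore (N : Submodule k R) : Ideal R where
  carrier := {p | ∀ h, h * p ∈ N}
  zero_mem' h := by rw [mul_zero]; exact N.zero_mem
  add_mem' hp hq h := by rw [mul_add]; exact N.add_mem (hp h) (hq h)
  smul_mem' t p hp h := by rw [smul_eq_mul, ← mul_assoc]; exact hp (h * t)

theorem mem_idealCore {N : Submodule k R} {p : R} : p ∈ idealCore N ↔ ∀ h, h * p ∈ N := Iff.rfl

theorem derivation_mem_idealCore {N : Submodule k R} {d : Derivation k R R} {c : R}
    (hN : ∀ q ∈ N, d q + c * q ∈ N) {p : R} (hp : p ∈ idealCore N) : d p ∈ idealCore N := by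
  refine mem_idealCore.2 fun h => ?_
  have hleibniz : h * d p = (d (h * p) + c * (h * p)) - (d h + c * h) * p := by
    rw [Derivation.leibniz, smul_eq_mul, smul_eq_mul]; ring
  rw [hleibniz]
  exact N.sub_mem (hN _ (hp h)) (hp _)

end IdealCore

section Semiinvariants

variable {R A : Type*} [CommRing R] [CommRing A] [Algebra R A]

theorem derivation_mul_eq_mul {d : Derivation R A A} {u v s t : A} (hu : d u = u * s)
    (hv : d v = v * t) : d (u * v) = u * v * (s + t) := by
  rw [Derivation.leibniz, hu, hv, smul_eq_mul, smul_eq_mul]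
  ring

theorem derivation_pow_eq_mul {d : Derivation R A A} {u s : A} (hu : d u = u * s) (m : ℕ) :
    d (u ^ m) = u ^ m * (m * s) := by
  induction m with
  | zero => simp
  | succ m ih =>
    rw [pow_succ, derivation_mul_eq_mul ih hu]
    push_cast
    ring

end Semiinvariants

namespace PositiveWitt

open MvPolynomial

section Plane

variable {k : Type*} [CommRing k]

/-- The basis `x ^ a * y ^ b` of `k[x, y]`. -/
def monomialBasis (k : Type*) [CommRing k] : Module.Basis (ℕ × ℕ) k (MvPolynomial (Fin 2) k) :=
  (basisMonomials (Fin 2) k).reindex (Finsupp.equivFunOnFinite.trans (finTwoArrowEquiv ℕ))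

theorem monomialBasis_apply (u : ℕ × ℕ) : monomialBasis k u = X 0 ^ u.1 * X 1 ^ u.2 := by
  rw [monomialBasis, Module.Basis.reindex_apply, coe_basisMonomials]
  exact (monomial_eq (R := k)).trans (by simp [Finsupp.prod_fintype])

/-- The exchange of the two variables of `k[x, y]`. -/
def swapVars : MvPolynomial (Fin 2) k →ₐ[k] MvPolynomial (Fin 2) k := aeval ![X 1, X 0]

@[simp]
theorem swapVars_X_zero : swapVars (X 0 : MvPolynomial (Fin 2) k) = X 1 := by simp [swapVars]

@[simp]
theorem swapVars_X_one : swapVars (X 1 : MvPolynomial (Fin 2) k) = X 0 := by simp [swapVars]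

@[simp]
theorem swapVars_swapVars (h : MvPolynomial (Fin 2) k) : swapVars (swapVars h) = h := by
  have hid : (swapVars (k := k)).comp swapVars = AlgHom.id k _ := by
    ext i
    fin_cases i <;> simp
  exact DFunLike.congr_fun hid h

/-- The vector field `x i ^ 2 ∂/∂(x i)`, with respect to which the action of `W₊` has the
simplest form: `e (n + 1)` is the vector field `x ^ n * (x ^ 2 d/dx)`. -/
def coordField (i : Fin 2) : Derivation k (MvPolynomial (Fin 2) k) (MvPolynomial (Fin 2) k) :=
  (X i ^ 2 : MvPolynomial (Fin 2) k) • pderiv i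

theorem coordField_apply (i : Fin 2) (q : MvPolynomial (Fin 2) k) :
    coordField i q = X i ^ 2 * pderiv i q := rfl

theorem coordField_X_pow_of_ne {i j : Fin 2} (h : j ≠ i) (n : ℕ) :
    coordField i (X j ^ n : MvPolynomial (Fin 2) k) = 0 := by
  rw [coordField_apply, pderiv_pow, pderiv_X_of_ne h, mul_zero, mul_zero]

theorem coordField_comm (i j : Fin 2) (q : MvPolynomial (Fin 2) k) :
    coordField i (coordField j q) = coordField j (coordField i q) := by
  obtain rfl | hij := eq_or_ne i j
  · rfl
  · simp only [coordField_apply, Derivation.leibniz, pderiv_pow, pderiv_X_of_ne hij,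
      pderiv_X_of_ne hij.symm, pderiv_pderiv_comm i j, smul_eq_mul, mul_zero, add_zero]
    ring

/-- The operator on `k[x, y]` by which `e (n + 1)` acts on `S²(W₊)`, when `x ^ a * y ^ b` stands for
`e (a + 1) * e (b + 1)`. -/
def wittOp (n : ℕ) : Module.End k (MvPolynomial (Fin 2) k) :=
  wronskianOp (coordField 0) (X 0 ^ n) + wronskianOp (coordField 1) (X 1 ^ n)

/-- The algebra of operators on `k[x, y]` generated by the action of `W₊`. Its submodules are the
subspaces stable under `W₊`. -/
abbrev wittOpAlgebra (k : Type*) [CommRing k] :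
    Subalgebra k (Module.End k (MvPolynomial (Fin 2) k)) :=
  Algebra.adjoin k (Set.range wittOp)

theorem wittOp_mem {N : Submodule (wittOpAlgebra k) (MvPolynomial (Fin 2) k)} (n : ℕ)
    {q : MvPolynomial (Fin 2) k} (hq : q ∈ N) : wittOp n q ∈ N :=
  apply_mem_of_mem_adjoin N (Set.mem_range_self n) hq

/-- The vector field `x ^ (n + 2) ∂/∂x + y ^ (n + 2) ∂/∂y`. -/
def vectorField (n : ℕ) : Derivation k (MvPolynomial (Fin 2) k) (MvPolynomial (Fin 2) k) :=
  (X 0 ^ n : MvPolynomial (Fin 2) k) • coordField 0 +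
    (X 1 ^ n : MvPolynomial (Fin 2) k) • coordField 1

theorem vectorField_apply (n : ℕ) (q : MvPolynomial (Fin 2) k) :
    vectorField n q = X 0 ^ n * coordField 0 q + X 1 ^ n * coordField 1 q := rfl

theorem vectorField_X (n : ℕ) (i : Fin 2) :
    vectorField n (X i : MvPolynomial (Fin 2) k) = X i ^ (n + 2) := by
  fin_cases i <;> simp [vectorField_apply, coordField_apply, pow_add]

theorem coordField_X_pow (i : Fin 2) (n : ℕ) :
    coordField i (X i ^ n) = (n : MvPolynomial (Fin 2) k) * X i ^ (n + 1) := by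
  cases n with
  | zero => simp
  | succ n => rw [coordField_apply, pderiv_pow, pderiv_X_self, Nat.add_sub_cancel]; ring

theorem wittOp_apply (n : ℕ) (q : MvPolynomial (Fin 2) k) :
    wittOp n q = vectorField n q
      - (n : MvPolynomial (Fin 2) k) * (X 0 ^ (n + 1) + X 1 ^ (n + 1)) * q := by
  simp only [wittOp, LinearMap.add_apply, wronskianOp_apply, coordField_X_pow,
    vectorField_apply]
  ring

theorem third_difference_wittOp (i j : ℕ) (q : MvPolynomial (Fin 2) k) :
    wittOp (i + 3) (wittOp j q) - 3 • wittOp (i + 2) (wittOp (j + 1) q)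
      + 3 • wittOp (i + 1) (wittOp (j + 2) q) - wittOp i (wittOp (j + 3) q) =
    crossOp (coordField 0) (coordField 1)
      ((X 0 - X 1) ^ 3 * (X 0 ^ i * X 1 ^ j - X 1 ^ i * X 0 ^ j)) q := by
  have mixed (a b : ℕ) :
      wronskianOp (coordField 0) (X 0 ^ a) (wronskianOp (coordField 1) (X 1 ^ b) q) =
        crossOp (coordField 0) (coordField 1) (X 0 ^ a * X 1 ^ b) q :=
    wronskianOp_wronskianOp (coordField_comm 0 1) (coordField_X_pow_of_ne (by decide) a)
      (coordField_X_pow_of_ne (by decide) b) q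
  have mixed' (a b : ℕ) :
      wronskianOp (coordField 1) (X 1 ^ a) (wronskianOp (coordField 0) (X 0 ^ b) q) =
        crossOp (coordField 0) (coordField 1) (X 1 ^ a * X 0 ^ b) q := by
    rw [crossOp_comm (coordField_comm 0 1)]
    exact wronskianOp_wronskianOp (coordField_comm 1 0) (coordField_X_pow_of_ne (by decide) a)
      (coordField_X_pow_of_ne (by decide) b) q
  have diagonal (l : Fin 2) :=
    third_difference_wronskianOp (coordField l) (X l) (X l ^ i) (X l ^ j) q
  have symbol : ((X 0 - X 1) ^ 3 * (X 0 ^ i * X 1 ^ j - X 1 ^ i * X 0 ^ j) :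
      MvPolynomial (Fin 2) k) =
      X 0 ^ (i + 3) * X 1 ^ j - 3 • (X 0 ^ (i + 2) * X 1 ^ (j + 1))
        + 3 • (X 0 ^ (i + 1) * X 1 ^ (j + 2)) - X 0 ^ i * X 1 ^ (j + 3)
      + (X 1 ^ (i + 3) * X 0 ^ j - 3 • (X 1 ^ (i + 2) * X 0 ^ (j + 1))
        + 3 • (X 1 ^ (i + 1) * X 0 ^ (j + 2)) - X 1 ^ i * X 0 ^ (j + 3)) := by
    ring
  simp only [symbol, map_add, map_sub, map_nsmul, LinearMap.add_apply, LinearMap.sub_apply,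
    LinearMap.smul_apply, ← mixed, ← mixed', wittOp]
  simp only [← pow_add, ← pow_succ', add_comm _ i, add_comm _ j] at diagonal
  linear_combination diagonal 0 + diagonal 1

end Plane

section StableSubspaces

variable {k : Type*} [CommRing k] {N : Submodule k (MvPolynomial (Fin 2) k)}
  (hN : ∀ n, ∀ q ∈ N, wittOp n q ∈ N)
include hN

theorem crossOp_antisymmetrized_mem {q : MvPolynomial (Fin 2) k} (hq : q ∈ N)
    (h : MvPolynomial (Fin 2) k) :
    crossOp (coordField 0) (coordField 1) ((X 0 - X 1) ^ 3 * (h - swapVars h)) q ∈ N := by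
  have hW (i j : ℕ) : wittOp i (wittOp j q) ∈ N := hN i _ (hN j q hq)
  have hbasis (u : ℕ × ℕ) : crossOp (coordField 0) (coordField 1)
      ((X 0 - X 1) ^ 3 * (monomialBasis k u - swapVars (monomialBasis k u))) q ∈ N := by
    have hswap : swapVars (monomialBasis k u) = X 1 ^ u.1 * X 0 ^ u.2 := by
      rw [monomialBasis_apply, map_mul, map_pow, map_pow, swapVars_X_zero, swapVars_X_one]
    rw [hswap, monomialBasis_apply, ← third_difference_wittOp]
    exact N.sub_mem (N.add_mem (N.sub_mem (hW _ _) (nsmul_mem (hW _ _) 3))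
      (nsmul_mem (hW _ _) 3)) (hW _ _)
  induction (monomialBasis k).mem_span h using Submodule.span_induction with
  | mem h hh => obtain ⟨u, rfl⟩ := hh; exact hbasis u
  | zero => simp
  | add h h' _ _ hh hh' =>
    rw [map_add, add_sub_add_comm, mul_add, map_add]
    exact N.add_mem hh hh'
  | smul c h _ hh =>
    rw [map_smul, ← smul_sub, mul_smul_comm, map_smul]
    exact N.smul_mem c hh

theorem mul_pderiv_mem_idealCore (i : Fin 2) {p : MvPolynomial (Fin 2) k}
    (hp : p ∈ idealCore N) :
    X 0 ^ 2 * X 1 ^ 2 * (X 0 - X 1) * pderiv i p ∈ idealCore N := by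
  have hv (n : ℕ) : vectorField n p ∈ idealCore N :=
    derivation_mem_idealCore
      (c := -((n : MvPolynomial (Fin 2) k) * (X 0 ^ (n + 1) + X 1 ^ (n + 1))))
      (fun q hq => by
        rw [neg_mul, ← sub_eq_add_neg, ← wittOp_apply]
        exact hN n q hq) hp
  fin_cases i
  · convert (idealCore N).mul_mem_left (X 1 ^ 2)
      (sub_mem (hv 1) ((idealCore N).mul_mem_left (X 1) (hv 0))) using 1
    simp only [vectorField_apply, coordField_apply, Fin.zero_eta]
    ring
  · convert (idealCore N).mul_mem_left (X 0 ^ 2)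
      (sub_mem ((idealCore N).mul_mem_left (X 0) (hv 0)) (hv 1)) using 1
    simp only [vectorField_apply, coordField_apply, Fin.mk_one]
    ring

end StableSubspaces

section SymmetricMultiples

variable {k : Type*} [Field k] [CharZero k] {N : Submodule k (MvPolynomial (Fin 2) k)}
  (hN : ∀ n, ∀ q ∈ N, wittOp n q ∈ N) {h q : MvPolynomial (Fin 2) k}
include hN

theorem crossOp_symmetric_mem (hh : swapVars h = h) (hq : q ∈ N) :
    crossOp (coordField 0) (coordField 1) ((X 0 - X 1) ^ 4 * h) q ∈ N := by
  have hhalf : (X 0 - X 1) * h = (2⁻¹ : k) • ((X 0 - X 1) * h) -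
      swapVars ((2⁻¹ : k) • ((X 0 - X 1) * h)) := by
    rw [map_smul, map_mul, map_sub, swapVars_X_zero, swapVars_X_one, hh, ← smul_sub,
      eq_inv_smul_iff₀ two_ne_zero, two_smul]
    ring
  rw [pow_succ, mul_assoc, hhalf]
  exact crossOp_antisymmetrized_mem hN hq _

theorem symmetric_mul_mem (hh : swapVars h = h) (hq : q ∈ N) :
    X 0 ^ 4 * X 1 ^ 4 * (X 0 - X 1) ^ 8 * h * q ∈ N := by
  set s : MvPolynomial (Fin 2) k := X 0 + X 1
  have hs : swapVars s = s := by simp [s, add_comm]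
  have hs₀ : coordField 0 s = X 0 ^ 2 := by simp [s, coordField_apply]
  have hs₁ : coordField 1 s = X 1 ^ 2 := by simp [s, coordField_apply]
  have hcross (i j : ℕ) : crossOp (coordField 0) (coordField 1) (s ^ i * ((X 0 - X 1) ^ 4 * h))
      (crossOp (coordField 0) (coordField 1) (s ^ j * (X 0 - X 1) ^ 4) q) ∈ N := by
    rw [mul_left_comm, mul_comm (s ^ j)]
    exact crossOp_symmetric_mem hN (by rw [map_mul, map_pow, hs, hh])
      (crossOp_symmetric_mem hN (by rw [map_pow, hs]) hq)
  have h₀ := hcross 0 4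
  have h₁ := hcross 1 3
  have h₃ := hcross 3 1
  have h₄ := hcross 4 0
  rw [pow_zero, one_mul] at h₀ h₄
  rw [pow_one] at h₁ h₃
  have hmem := N.add_mem (N.sub_mem (N.add_mem (N.sub_mem h₄ (nsmul_mem h₃ 4))
    (nsmul_mem (hcross 2 2) 6)) (nsmul_mem h₁ 4)) h₀
  rw [fourth_difference_crossOp (by rw [hs₁, coordField_X_pow_of_ne (by decide)]), hs₀, hs₁,
    ← Nat.cast_smul_eq_nsmul k, N.smul_mem_iff (by norm_num)] at hmem
  convert hmem using 1
  ring

theorem mul_mem_of_antisymmetric_mem (hanti : ∀ p, p - swapVars p ∈ N)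
    (hsymm : swapVars q = q) (hq : q ∈ N) (h : MvPolynomial (Fin 2) k) :
    X 0 ^ 4 * X 1 ^ 4 * (X 0 - X 1) ^ 8 * h * q ∈ N := by
  set g : MvPolynomial (Fin 2) k := X 0 ^ 4 * X 1 ^ 4 * (X 0 - X 1) ^ 8
  have hg : swapVars g = g := by
    simp only [g, map_mul, map_pow, map_sub, swapVars_X_zero, swapVars_X_one]
    ring
  have hmem : g * (h + swapVars h) * q + (g * h * q - swapVars (g * h * q)) ∈ N :=
    N.add_mem (symmetric_mul_mem hN (by simp [add_comm]) hq) (hanti (g * h * q))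
  have htwo : g * (h + swapVars h) * q + (g * h * q - swapVars (g * h * q)) =
      (2 : k) • (g * h * q) := by
    rw [map_mul, map_mul, hg, hsymm, two_smul]
    ring
  rwa [htwo, N.smul_mem_iff two_ne_zero] at hmem

theorem exists_pow_mem_idealCore (hanti : ∀ p, p - swapVars p ∈ N)
    (hsymm : swapVars q = q) (hq : q ∈ N) (hq0 : q ≠ 0) :
    ∃ m : ℕ, (X 0 ^ 2 * X 1 ^ 2 * (X 0 - X 1)) ^ m ∈ idealCore N := by
  have hg : (X 0 ^ 4 * X 1 ^ 4 * (X 0 - X 1) ^ 8 : MvPolynomial (Fin 2) k) ≠ 0 :=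
    mul_ne_zero (mul_ne_zero (pow_ne_zero _ (X_ne_zero 0)) (pow_ne_zero _ (X_ne_zero 1)))
      (pow_ne_zero _ (sub_ne_zero.2 fun h => by simpa using X_injective h))
  refine exists_pow_mem_of_mul_pderiv_mem (fun i p hp => mul_pderiv_mem_idealCore hN i hp)
    (mul_ne_zero hg hq0) (mem_idealCore.2 fun h => ?_)
  rw [mul_left_comm, ← mul_assoc]
  exact mul_mem_of_antisymmetric_mem hN hanti hsymm hq h

end SymmetricMultiples

section WeightSubmodule

variable {k : Type*} [CommRing k]

/-- The polynomials `x ^ a * y ^ b * (x - y) ^ c`. Each vector field `x ^ n ∂/∂x + y ^ n ∂/∂y` with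
`n ≥ 2` multiplies them by a polynomial, so that their multiples are stable under `W₊`. -/
def weight (a b c : ℕ) : MvPolynomial (Fin 2) k := X 0 ^ a * X 1 ^ b * (X 0 - X 1) ^ c

/-- The zeroth order term by which the action of `W₊` on the multiples `weight a b c * h` differs
from the action of vector fields on `h`. -/
def twist (a b c n : ℕ) : MvPolynomial (Fin 2) k :=
  (a : MvPolynomial (Fin 2) k) * X 0 ^ (n + 1) + (b : MvPolynomial (Fin 2) k) * X 1 ^ (n + 1)
    + (c : MvPolynomial (Fin 2) k) * ∑ i ∈ Finset.range (n + 2), X 0 ^ i * X 1 ^ (n + 1 - i)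
    - (n : MvPolynomial (Fin 2) k) * (X 0 ^ (n + 1) + X 1 ^ (n + 1))

theorem wittOp_weight_mul (a b c n : ℕ) (h : MvPolynomial (Fin 2) k) :
    wittOp n (weight a b c * h) = weight a b c * (vectorField n h + twist a b c n * h) := by
  have hX (i : Fin 2) :
      vectorField n (X i : MvPolynomial (Fin 2) k) = X i * X i ^ (n + 1) := by
    rw [vectorField_X, ← pow_succ']
  have hdiff : vectorField n (X 0 - X 1 : MvPolynomial (Fin 2) k) =
      (X 0 - X 1) * ∑ i ∈ Finset.range (n + 2), X 0 ^ i * X 1 ^ (n + 1 - i) := by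
    rw [map_sub, vectorField_X, vectorField_X]
    exact ((Commute.all (X 0) (X 1)).mul_geom_sum₂ (n + 2)).symm
  rw [wittOp_apply, Derivation.leibniz, weight, derivation_mul_eq_mul (derivation_mul_eq_mul
    (derivation_pow_eq_mul (hX 0) a) (derivation_pow_eq_mul (hX 1) b))
    (derivation_pow_eq_mul hdiff c), twist, smul_eq_mul, smul_eq_mul]
  ring

/-- The multiples of `weight a b c`, as a submodule for the action of `W₊`. -/
def weightSubmodule (k : Type*) [CommRing k] (a b c : ℕ) :
    Submodule (wittOpAlgebra k) (MvPolynomial (Fin 2) k) :=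
  invariantSubmodule _ ((Ideal.span {weight a b c}).restrictScalars k) <| by
    rintro _ ⟨n, rfl⟩ _ hq
    obtain ⟨h, rfl⟩ := Ideal.mem_span_singleton.1 hq
    exact Ideal.mem_span_singleton.2 ⟨_, wittOp_weight_mul a b c n h⟩

theorem mem_weightSubmodule {a b c : ℕ} {q : MvPolynomial (Fin 2) k} :
    q ∈ weightSubmodule k a b c ↔ weight a b c ∣ q :=
  (mem_invariantSubmodule _).trans Ideal.mem_span_singleton

end WeightSubmodule

section WeightFiltration

variable {k : Type*} [Field k]

theorem wellFoundedGT_Ici_weightSubmodule_of_mul {a b c a' b' c' : ℕ}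
    {l : MvPolynomial (Fin 2) k} (hl : weight a' b' c' = weight a b c * l) {i : Fin 2}
    {φ : MvPolynomial (Fin 2) k →ₐ[k] Polynomial k}
    (hφ : ∀ j, l ∣ X j - Polynomial.aeval (X i) (φ (X j))) {κ : ℕ → k}
    (htwist : ∀ n, φ (twist a b c n) = Polynomial.C (κ n) * Polynomial.X ^ (n + 1))
    (hκ : ∀ d : ℕ, ∃ m, ∀ n ≥ m, (d : k) + κ n ≠ 0)
    (h : WellFoundedGT (Set.Ici (weightSubmodule k a b c))) :
    WellFoundedGT (Set.Ici (weightSubmodule k a' b' c')) := by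
  have hle : weightSubmodule k a' b' c' ≤ weightSubmodule k a b c := fun q hq =>
    mem_weightSubmodule.2 ((Dvd.intro l hl.symm).trans (mem_weightSubmodule.1 hq))
  let f : Polynomial k →ₗ[k] MvPolynomial (Fin 2) k :=
    LinearMap.mulLeft k (weight a b c) ∘ₗ (Polynomial.aeval (X i)).toLinearMap
  have hf (v : Polynomial k) : f v = weight a b c * Polynomial.aeval (X i) v := rfl
  refine wellFoundedGT_Ici_of_densityOp (A := wittOpAlgebra k) hle h hκ (f := f)
    (fun v => mem_weightSubmodule.2 ⟨_, hf v⟩) (fun q hq => ?_)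
    fun n => ⟨⟨wittOp n, Algebra.subset_adjoin ⟨n, rfl⟩⟩, fun v => ?_⟩
  · obtain ⟨p, rfl⟩ := mem_weightSubmodule.1 hq
    refine ⟨φ p, mem_weightSubmodule.2 ?_⟩
    rw [hl, hf, ← mul_sub]
    exact mul_dvd_mul_left _ (dvd_sub_aeval hφ p)
  · have hv : vectorField n (Polynomial.aeval (X i : MvPolynomial (Fin 2) k) v) =
        X i ^ (n + 2) * Polynomial.aeval (X i) (Polynomial.derivative v) := by
      rw [Derivation.map_aeval, vectorField_X, smul_eq_mul, mul_comm]
    have hop : wittOp n (f v) - f (densityOp n (κ n) v) =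
        weight a b c * ((twist a b c n - Polynomial.aeval (X i) (φ (twist a b c n)))
          * Polynomial.aeval (X i) v) := by
      rw [hf, hf, wittOp_weight_mul, hv, htwist, densityOp_apply]
      simp only [map_add, map_mul, map_pow, Polynomial.aeval_X]
      ring
    refine mem_weightSubmodule.2 ?_
    rw [hl]
    exact hop ▸ mul_dvd_mul_left _ (Dvd.dvd.mul_right (dvd_sub_aeval hφ _) _)

section Steps

variable [CharZero k] {a b c : ℕ}

theorem wellFoundedGT_Ici_weightSubmodule_succ_left
    (h : WellFoundedGT (Set.Ici (weightSubmodule k a b c))) :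
    WellFoundedGT (Set.Ici (weightSubmodule k (a + 1) b c)) := by
  refine wellFoundedGT_Ici_weightSubmodule_of_mul (l := X 0) (i := 1)
    (φ := aeval ![0, Polynomial.X]) (κ := fun n => (b : k) + c - n)
    (by rw [weight, weight]; ring) (fun j => ?_) (fun n => ?_)
    (fun d => ⟨d + b + c + 1, fun n hn => ?_⟩) h
  · fin_cases j <;> simp
  · simp only [twist, map_add, map_sub, map_mul, map_pow, map_natCast, map_sum, aeval_X,
      Matrix.cons_val_zero, Matrix.cons_val_one, Finset.sum_range_succ' _ (n + 1),
      pow_succ, mul_zero, zero_mul, pow_zero, one_mul, tsub_zero, Finset.sum_const_zero]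
    ring
  · have : ((d + b + c - n : ℤ) : k) ≠ 0 := Int.cast_ne_zero.2 (by omega)
    push_cast at this
    rwa [← add_sub_assoc, ← add_assoc]

theorem wellFoundedGT_Ici_weightSubmodule_succ_middle
    (h : WellFoundedGT (Set.Ici (weightSubmodule k a b c))) :
    WellFoundedGT (Set.Ici (weightSubmodule k a (b + 1) c)) := by
  refine wellFoundedGT_Ici_weightSubmodule_of_mul (l := X 1) (i := 0)
    (φ := aeval ![Polynomial.X, 0]) (κ := fun n => (a : k) + c - n)
    (by rw [weight, weight]; ring) (fun j => ?_) (fun n => ?_)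
    (fun d => ⟨d + a + c + 1, fun n hn => ?_⟩) h
  · fin_cases j <;> simp
  · have hsum : ∑ i ∈ Finset.range (n + 2), (Polynomial.X : Polynomial k) ^ i * 0 ^ (n + 1 - i) =
        Polynomial.X ^ (n + 1) := by
      rw [Finset.sum_range_succ, Finset.sum_eq_zero fun i hi => ?_]
      · simp
      · rw [zero_pow (Nat.sub_ne_zero_of_lt (Finset.mem_range.1 hi)), mul_zero]
    simp only [twist, map_add, map_sub, map_mul, map_pow, map_natCast, map_sum, aeval_X,
      Matrix.cons_val_zero, Matrix.cons_val_one, hsum]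
    ring
  · have : ((d + a + c - n : ℤ) : k) ≠ 0 := Int.cast_ne_zero.2 (by omega)
    push_cast at this
    rwa [← add_sub_assoc, ← add_assoc]

theorem wellFoundedGT_Ici_weightSubmodule_succ_right
    (h : WellFoundedGT (Set.Ici (weightSubmodule k a b c))) :
    WellFoundedGT (Set.Ici (weightSubmodule k a b (c + 1))) := by
  refine wellFoundedGT_Ici_weightSubmodule_of_mul (l := X 0 - X 1) (i := 1)
    (φ := aeval ![Polynomial.X, Polynomial.X])
    (κ := fun n => (a : k) + b + c * (n + 2 : ℕ) - 2 * n)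
    (by rw [weight, weight]; ring) (fun j => ?_) (fun n => ?_)
    (fun d => ⟨d + a + b + 3, fun n hn => ?_⟩) h
  · fin_cases j <;> simp
  · have hsum : ∑ i ∈ Finset.range (n + 2),
        (Polynomial.X : Polynomial k) ^ i * Polynomial.X ^ (n + 1 - i) =
        (n + 2 : ℕ) * Polynomial.X ^ (n + 1) := geom_sum₂_self _ _
    simp only [twist, map_add, map_sub, map_mul, map_pow, map_natCast, map_sum, aeval_X,
      Matrix.cons_val_zero, Matrix.cons_val_one, hsum, Polynomial.C_ofNat]
    ring
  · have : ((d + (a + b + c * (n + 2) - 2 * n) : ℤ) : k) ≠ 0 := by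
      refine Int.cast_ne_zero.2 ?_
      obtain rfl | rfl | ⟨c, rfl⟩ : c = 0 ∨ c = 1 ∨ ∃ c', c = c' + 2 := by
        rcases c with _ | _ | c <;> simp
      · omega
      · omega
      · have : (0 : ℤ) ≤ c * (n + 2) := by positivity
        push_cast
        linarith
    push_cast at this ⊢
    exact this

end Steps

theorem wellFoundedGT_Ici_weightSubmodule [CharZero k] (a b c : ℕ) :
    WellFoundedGT (Set.Ici (weightSubmodule k a b c)) := by
  induction a with
  | succ a ih => exact wellFoundedGT_Ici_weightSubmodule_succ_left ih
  | zero =>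
    induction b with
    | succ b ih => exact wellFoundedGT_Ici_weightSubmodule_succ_middle ih
    | zero =>
      induction c with
      | succ c ih => exact wellFoundedGT_Ici_weightSubmodule_succ_right ih
      | zero =>
        have htop : weightSubmodule k 0 0 0 = ⊤ :=
          eq_top_iff.2 fun q _ => mem_weightSubmodule.2 (by simp [weight])
        rw [htop, Set.Ici_top]
        infer_instance

end WeightFiltration

section Comparison

open SymmetricAlgebra (ι symPow lie_ι lie_mul)

variable {k : Type*} [Field k]

theorem ι_mul_ι_mem_symPow (x y : PositiveWitt k) :
    ι k (PositiveWitt k) x * ι k (PositiveWitt k) y ∈ symPow k (PositiveWitt k) 2 := by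
  change _ ∈ LinearMap.range (ι k (PositiveWitt k)) ^ 2
  rw [pow_two]
  exact Submodule.mul_mem_mul ⟨x, rfl⟩ ⟨y, rfl⟩

/-- The linear map `k[x, y] → S²(W₊)` with `x ^ a * y ^ b ↦ e (a + 1) * e (b + 1)`, which turns
`wittOp n` into the action of `e (n + 1)`. -/
def toSymPow : MvPolynomial (Fin 2) k →ₗ[k] symPow k (PositiveWitt k) 2 :=
  (monomialBasis k).constr k fun u =>
    ⟨ι k (PositiveWitt k) (e u.1.succPNat) * ι k (PositiveWitt k) (e u.2.succPNat),
      ι_mul_ι_mem_symPow _ _⟩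

theorem coe_toSymPow_X_pow_mul_X_pow (a b : ℕ) :
    (toSymPow (X 0 ^ a * X 1 ^ b : MvPolynomial (Fin 2) k) :
        SymmetricAlgebra k (PositiveWitt k)) =
      ι k (PositiveWitt k) (e a.succPNat) * ι k (PositiveWitt k) (e b.succPNat) := by
  rw [← monomialBasis_apply (a, b), toSymPow, Module.Basis.constr_basis]

theorem toSymPow_swapVars (h : MvPolynomial (Fin 2) k) : toSymPow (swapVars h) = toSymPow h := by
  have hmap : toSymPow ∘ₗ swapVars.toLinearMap = toSymPow (k := k) :=
    (monomialBasis k).ext fun u => Subtype.ext <| by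
      rw [LinearMap.comp_apply, AlgHom.toLinearMap_apply, monomialBasis_apply, map_mul, map_pow,
        map_pow, swapVars_X_zero, swapVars_X_one, mul_comm, coe_toSymPow_X_pow_mul_X_pow,
        coe_toSymPow_X_pow_mul_X_pow, mul_comm]
  exact LinearMap.congr_fun hmap h

theorem wittOp_X_pow_mul_X_pow (n a b : ℕ) :
    wittOp n (X 0 ^ a * X 1 ^ b : MvPolynomial (Fin 2) k) =
      ((a : k) - n) • (X 0 ^ (n + a + 1) * X 1 ^ b) +
        ((b : k) - n) • (X 0 ^ a * X 1 ^ (n + b + 1)) := by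
  simp only [wittOp_apply, vectorField_apply, Derivation.leibniz, coordField_X_pow,
    coordField_X_pow_of_ne one_ne_zero, coordField_X_pow_of_ne zero_ne_one, smul_eq_mul,
    smul_eq_C_mul, map_sub, map_natCast]
  ring

theorem lie_ι_e_mul_ι_e (n a b : ℕ) :
    ⁅(e n.succPNat : PositiveWitt k),
        ι k (PositiveWitt k) (e a.succPNat) * ι k (PositiveWitt k) (e b.succPNat)⁆ =
      ((a : k) - n) • (ι k (PositiveWitt k) (e (n + a + 1).succPNat) *
          ι k (PositiveWitt k) (e b.succPNat)) +
        ((b : k) - n) • (ι k (PositiveWitt k) (e a.succPNat) *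
          ι k (PositiveWitt k) (e (n + b + 1).succPNat)) := by
  have hsucc (m : ℕ) : n.succPNat + m.succPNat = (n + m + 1).succPNat :=
    PNat.eq (by simp only [PNat.add_coe, Nat.succPNat_coe]; omega)
  rw [lie_mul, lie_ι, lie_ι, lie_e_e, lie_e_e, hsucc, hsucc, map_smul, map_smul, mul_smul_comm,
    mul_smul_comm, add_comm, mul_comm (ι k (PositiveWitt k) (e b.succPNat))]
  simp only [Nat.succPNat_coe, Nat.cast_succ, add_sub_add_right_eq_sub]

theorem toSymPow_wittOp (n : ℕ) (h : MvPolynomial (Fin 2) k) :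
    toSymPow (wittOp n h) = ⁅(e n.succPNat : PositiveWitt k), toSymPow h⁆ := by
  have hmap : toSymPow ∘ₗ wittOp n =
      LieModule.toEnd k (PositiveWitt k) _ (e n.succPNat) ∘ₗ toSymPow (k := k) :=
    (monomialBasis k).ext fun u => Subtype.ext <| by
      rw [LinearMap.comp_apply, LinearMap.comp_apply, monomialBasis_apply,
        wittOp_X_pow_mul_X_pow, map_add, map_smul, map_smul, LieModule.toEnd_apply_apply,
        LieSubmodule.coe_bracket, coe_toSymPow_X_pow_mul_X_pow, lie_ι_e_mul_ι_e,
        ← coe_toSymPow_X_pow_mul_X_pow, ← coe_toSymPow_X_pow_mul_X_pow]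
      rfl
  exact LinearMap.congr_fun hmap h

theorem toSymPow_surjective : Function.Surjective (toSymPow (k := k)) := by
  have hι : LinearMap.range (ι k (PositiveWitt k)) =
      Submodule.span k (Set.range fun i => ι k (PositiveWitt k) (e i)) := by
    rw [LinearMap.range_eq_map, ← e.span_eq, Submodule.map_span, ← Set.range_comp]
    rfl
  have hle : LinearMap.range (ι k (PositiveWitt k)) ^ 2 ≤
      LinearMap.range ((symPow k (PositiveWitt k) 2).toSubmodule.subtype ∘ₗ toSymPow) := by
    rw [pow_two, hι, Submodule.span_mul_span, Submodule.span_le]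
    rintro _ ⟨_, ⟨i, rfl⟩, _, ⟨j, rfl⟩, rfl⟩
    refine ⟨X 0 ^ i.natPred * X 1 ^ j.natPred, (coe_toSymPow_X_pow_mul_X_pow _ _).trans ?_⟩
    rw [PNat.succPNat_natPred, PNat.succPNat_natPred]
  rintro ⟨p, hp⟩
  obtain ⟨h, hh⟩ := hle hp
  exact ⟨h, Subtype.ext hh⟩

/-- The preimage in `k[x, y]` of a `W₊`-submodule of `S²(W₊)`. -/
def pullback (N : LieSubmodule k (PositiveWitt k) (symPow k (PositiveWitt k) 2)) :
    Submodule (wittOpAlgebra k) (MvPolynomial (Fin 2) k) :=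
  invariantSubmodule _ (N.toSubmodule.comap toSymPow) <| by
    rintro _ ⟨n, rfl⟩ q hq
    rw [Submodule.mem_comap, toSymPow_wittOp]
    exact N.lie_mem hq

theorem mem_pullback {N : LieSubmodule k (PositiveWitt k) (symPow k (PositiveWitt k) 2)}
    {q : MvPolynomial (Fin 2) k} : q ∈ pullback N ↔ toSymPow q ∈ N :=
  mem_invariantSubmodule _

theorem pullback_strictMono : StrictMono (pullback (k := k)) := by
  refine Monotone.strictMono_of_injective (fun N N' h q hq => h hq) fun N N' h => ?_
  ext v
  obtain ⟨q, rfl⟩ := toSymPow_surjective v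
  rw [← mem_pullback, h, mem_pullback]

theorem sub_swapVars_mem_pullback
    (N : LieSubmodule k (PositiveWitt k) (symPow k (PositiveWitt k) 2))
    (q : MvPolynomial (Fin 2) k) : q - swapVars q ∈ pullback N := by
  rw [mem_pullback, map_sub, toSymPow_swapVars, sub_self]
  exact N.zero_mem

theorem exists_symmetric_mem_pullback [CharZero k]
    {N : LieSubmodule k (PositiveWitt k) (symPow k (PositiveWitt k) 2)} (hN : N ≠ ⊥) :
    ∃ q ∈ pullback N, swapVars q = q ∧ q ≠ 0 := by
  obtain ⟨v, hvN, hv⟩ :=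
    N.toSubmodule.exists_mem_ne_zero_of_ne_bot (N.toSubmodule_eq_bot.not.2 hN)
  obtain ⟨q, rfl⟩ := toSymPow_surjective v
  have himage : toSymPow (q + swapVars q) = (2 : k) • toSymPow q := by
    rw [map_add, toSymPow_swapVars, two_smul]
  refine ⟨q + swapVars q, ?_, by rw [map_add, swapVars_swapVars, add_comm], fun h0 => ?_⟩
  · rw [mem_pullback, himage]
    exact N.smul_mem 2 hvN
  · rw [h0, map_zero] at himage
    exact smul_ne_zero two_ne_zero hv himage.symm

theorem exists_weightSubmodule_le_pullback [CharZero k]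
    {N : LieSubmodule k (PositiveWitt k) (symPow k (PositiveWitt k) 2)} (hN : N ≠ ⊥) :
    ∃ a b c, weightSubmodule k a b c ≤ pullback N := by
  obtain ⟨q, hq, hsymm, hq0⟩ := exists_symmetric_mem_pullback hN
  obtain ⟨m, hm⟩ := exists_pow_mem_idealCore
    (N := N.toSubmodule.comap toSymPow) (fun n _ => wittOp_mem (N := pullback N) n)
    (sub_swapVars_mem_pullback N) hsymm hq hq0
  refine ⟨2 * m, 2 * m, m, fun p hp => ?_⟩
  obtain ⟨h, rfl⟩ := mem_weightSubmodule.1 hp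
  rw [weight, pow_mul, pow_mul, ← mul_pow, ← mul_pow, mul_comm]
  exact mem_idealCore.1 hm h

end Comparison

end PositiveWitt

end

theorem theorem4p2 (k : Type*) [Field k] [CharZero k] :
    WellFoundedGT (LieSubmodule k (PositiveWitt k)
      (SymmetricAlgebra.symPow k (PositiveWitt k) 2)) := by
  refine wellFoundedGT_of_forall_Ici fun N hN => ?_
  obtain ⟨a, b, c, hle⟩ := PositiveWitt.exists_weightSubmodule_le_pullback hN
  have hwf := PositiveWitt.wellFoundedGT_Ici_weightSubmodule (k := k) a b c
  let pullbackIci (L : Set.Ici N) : Set.Ici (PositiveWitt.weightSubmodule k a b c) :=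
    ⟨PositiveWitt.pullback L.1, hle.trans (PositiveWitt.pullback_strictMono.monotone L.2)⟩
  have hpull : StrictMono pullbackIci := fun L L' h => PositiveWitt.pullback_strictMono h
  exact hpull.wellFoundedGT
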